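/- Let $\alpha \in \mathbb{R}$, $\alpha \neq 0$, and let $$\mathcal{F} = \bigoplus_{n \geq 0} L^2(\mathbb{R}_+, dx; \mathbb{C})^{\otimes n} = \mathbb{C}\Omega \oplus L^2(\mathbb{R}_+;\mathbb{C}) \oplus \cdots$$ be the full Fock space of $L^2(\mathbb{R}_+, dx)$ with its standard inner product (linear in the second argument) and vacuum vector $\Omega$. For real-valued $g \in L^1(\mathbb{R}_+) \cap L^2(\mathbb{R}_+)$ let $X(g)$ be the bounded operator on $\mathcal{F}$ determined by $X(g)\Omega = g$ and, for $n \geq 1$, $$X(g)(f_1 \otimes \cdots \otimes f_n) = g \otimes f_1 \otimes \cdots \otimes f_n + \alpha \Bigl(\int_{\mathbb{R}_+} g\,dx\Bigr) f_1 \otimes \cdots \otimes f_n + \langle g, f_1 \rangle\, f_2 \otimes \cdots \otimes f_n .$$ Put $X(t) = X(\mathbf{1}_{[0,t)})$, $T = 1/\alpha^2$, $C_T = 1 + \alpha X(T)$, let $\mathcal{A}_T = W^*(\{X(t) : 0 \leq t \leq T\})$ be the von Neumann algebra on $\mathcal{F}$ generated by the operators $X(t)$, $0 \le t \le T$, and define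 on $\mathcal{A}_T$ the linear functionals $$\phi[A] = \langle \Omega, A\Omega\rangle, \qquad \psi_T[A] = \phi[A C_T] = \langle \Omega, A C_T \Omega \rangle .$$ Then on $\mathcal{A}_T$ both $\phi$ and $\psi_T$ are faithful normal states, and moreover $\psi_T$ is tracial: $\psi_T[AB] = \psi_T[BA]$ for all $A, B \in \mathcal{A}_T$. -/

import Mathlib

open MeasureTheory
open scoped ENNReal InnerProductSpace Topology

noncomputable section

namespace TwoStateFree

/-! ### The full Fock space over `L²(ℝ₊)` -/

/-- Lebesgue measure on the half-line `ℝ₊ = [0, ∞)`. -/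
def halfLine : Measure ℝ := volume.restrict (Set.Ici 0)

instance : SigmaFinite halfLine := by unfold halfLine; infer_instance

/-- Lebesgue measure on `ℝ₊ⁿ`. -/
def orthant (n : ℕ) : Measure (Fin n → ℝ) := Measure.pi fun _ => halfLine

instance (n : ℕ) : SigmaFinite (orthant n) := by unfold orthant; infer_instance

/-- The (complexified) one-particle space `L²(ℝ₊, dx)`. -/
abbrev OneParticle : Type := Lp ℂ 2 halfLine

/-- The `n`-particle space: the Hilbert space tensor power `L²(ℝ₊)^{⊗ n}`, realized as
`L²(ℝ₊ⁿ)`, where `f₁ ⊗ ⋯ ⊗ fₙ` is the function `x ↦ f₁ (x 0) ⋯ fₙ (x (n - 1))`.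
For `n = 0` it is one-dimensional. -/
abbrev Particles (n : ℕ) : Type := Lp ℂ 2 (orthant n)

/-- The full Fock space of `L²(ℝ₊)`: the Hilbert space direct sum of all `L²(ℝ₊)^{⊗ n}`. -/
abbrev Fock : Type := lp Particles 2

/-- The constant function `1` on the one-point space `ℝ₊⁰` is square integrable. -/
theorem memLp_one_orthant_zero : MemLp (fun _ : Fin 0 → ℝ => (1 : ℂ)) 2 (orthant 0) := by
  have : IsFiniteMeasure (orthant 0) := by
    unfold orthant; rw [Measure.pi_of_empty]; infer_instance
  exact memLp_const 1

/-- The vacuum vector `Ω`. -/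
def vacuum : Fock := lp.single 2 0 (memLp_one_orthant_zero.toLp _)

/-! ### Creation and annihilation operators -/

theorem measurePreserving_headTail (n : ℕ) :
    MeasurePreserving (fun x : Fin (n + 1) → ℝ => (x 0, Fin.tail x)) (orthant (n + 1))
      (halfLine.prod (orthant n)) :=
  measurePreserving_piFinSuccAbove (fun _ : Fin (n + 1) => halfLine) 0

theorem eLpNorm_tensor (n : ℕ) {g : ℝ → ℂ} {f : (Fin n → ℝ) → ℂ}
    (hg : AEStronglyMeasurable g halfLine) (hf : AEStronglyMeasurable f (orthant n)) :
    eLpNorm (fun x : Fin (n + 1) → ℝ => g (x 0) * f (Fin.tail x)) 2 (orthant (n + 1)) =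
      eLpNorm g 2 halfLine * eLpNorm f 2 (orthant n) := by
  have hm : AEStronglyMeasurable (fun z : ℝ × (Fin n → ℝ) => g z.1 * f z.2)
      (halfLine.prod (orthant n)) := hg.comp_fst.mul hf.comp_snd
  have h1 := eLpNorm_comp_measurePreserving (p := 2) hm (measurePreserving_headTail n)
  have h2 : eLpNorm (fun z : ℝ × (Fin n → ℝ) => g z.1 * f z.2) 2 (halfLine.prod (orthant n)) =
      eLpNorm g 2 halfLine * eLpNorm f 2 (orthant n) := by
    simp only [eLpNorm_eq_lintegral_rpow_enorm_toReal (two_ne_zero) (ENNReal.ofNat_ne_top),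
      enorm_mul, ENNReal.toReal_ofNat]
    rw [← ENNReal.mul_rpow_of_nonneg _ _ (by norm_num), ← lintegral_prod_mul]
    · simp_rw [ENNReal.mul_rpow_of_nonneg _ _ (zero_le_two)]
    · exact hg.enorm.pow_const _
    · exact hf.enorm.pow_const _
  exact h1.trans h2

theorem memLp_tensor (n : ℕ) {g : ℝ → ℂ} {f : (Fin n → ℝ) → ℂ}
    (hg : MemLp g 2 halfLine) (hf : MemLp f 2 (orthant n)) :
    MemLp (fun x : Fin (n + 1) → ℝ => g (x 0) * f (Fin.tail x)) 2 (orthant (n + 1)) := by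
  refine ⟨(hg.1.comp_fst.mul hf.1.comp_snd).comp_measurePreserving
    (measurePreserving_headTail n), ?_⟩
  rw [eLpNorm_tensor n hg.1 hf.1]
  exact ENNReal.mul_lt_top hg.2 hf.2

/-- The tensor `g ⊗ f`, i.e. the function `x ↦ g (x 0) * f (x 1, …, x n)`. -/
def tensor {n : ℕ} (g : OneParticle) (f : Particles n) : Particles (n + 1) :=
  (memLp_tensor n (Lp.memLp g) (Lp.memLp f)).toLp _

theorem norm_tensor {n : ℕ} (g : OneParticle) (f : Particles n) :
    ‖tensor g f‖ = ‖g‖ * ‖f‖ := by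
  rw [tensor, Lp.norm_toLp, eLpNorm_tensor n (Lp.memLp g).1 (Lp.memLp f).1, ENNReal.toReal_mul,
    ← Lp.norm_def, ← Lp.norm_def]

theorem coeFn_tensor {n : ℕ} (g : OneParticle) (f : Particles n) :
    tensor g f =ᵐ[orthant (n + 1)] fun x => g (x 0) * f (Fin.tail x) :=
  MemLp.coeFn_toLp _

theorem quasiMeasurePreserving_tail (n : ℕ) :
    Measure.QuasiMeasurePreserving (fun x : Fin (n + 1) → ℝ => Fin.tail x)
      (orthant (n + 1)) (orthant n) :=
  Measure.quasiMeasurePreserving_snd.comp (measurePreserving_headTail n).quasiMeasurePreserving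

theorem tensor_add {n : ℕ} (g : OneParticle) (f₁ f₂ : Particles n) :
    tensor g (f₁ + f₂) = tensor g f₁ + tensor g f₂ := by
  apply Lp.ext
  filter_upwards [coeFn_tensor g (f₁ + f₂), coeFn_tensor g f₁, coeFn_tensor g f₂,
    Lp.coeFn_add (tensor g f₁) (tensor g f₂),
    (quasiMeasurePreserving_tail n).ae (Lp.coeFn_add f₁ f₂)] with x h h₁ h₂ h₃ h₄
  rw [h, h₃, Pi.add_apply, h₁, h₂, h₄, Pi.add_apply, mul_add]

theorem tensor_smul {n : ℕ} (g : OneParticle) (c : ℂ) (f : Particles n) :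
    tensor g (c • f) = c • tensor g f := by
  apply Lp.ext
  filter_upwards [coeFn_tensor g (c • f), coeFn_tensor g f, Lp.coeFn_smul c (tensor g f),
    (quasiMeasurePreserving_tail n).ae (Lp.coeFn_smul c f)] with x h h₁ h₂ h₃
  rw [h, h₂, Pi.smul_apply, h₁, h₃, Pi.smul_apply, smul_eq_mul, smul_eq_mul, mul_left_comm]

/-- The components of `g ⊗ ξ` for a Fock space vector `ξ`. -/
def creationFun (g : OneParticle) (ξ : Fock) : ∀ n, Particles n
  | 0 => 0
  | n + 1 => tensor g (ξ n)

theorem hasSum_creationFun (g : OneParticle) (ξ : Fock) :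
    HasSum (fun n => ‖creationFun g ξ n‖ ^ (2 : ℝ≥0∞).toReal)
      ((‖g‖ * ‖ξ‖) ^ (2 : ℝ≥0∞).toReal) := by
  rw [hasSum_nat_add_iff' 1 |>.symm]
  have h := (lp.hasSum_norm (by norm_num : 0 < (2 : ℝ≥0∞).toReal) ξ).mul_left
    (‖g‖ ^ (2 : ℝ≥0∞).toReal)
  simpa [creationFun, norm_tensor, mul_pow] using h

/-- The left creation operator `a⁺(g) : f₁ ⊗ ⋯ ⊗ fₙ ↦ g ⊗ f₁ ⊗ ⋯ ⊗ fₙ`, `Ω ↦ g`. -/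
def creation (g : OneParticle) : Fock →L[ℂ] Fock :=
  LinearMap.mkContinuous
    { toFun := fun ξ => ⟨creationFun g ξ, memℓp_gen (hasSum_creationFun g ξ).summable⟩
      map_add' := by
        intro ξ η
        ext1
        funext n
        cases n with
        | zero => exact (add_zero (0 : Particles 0)).symm
        | succ n => exact tensor_add g (ξ n) (η n)
      map_smul' := by
        intro c ξ
        ext1
        funext n
        cases n with
        | zero => exact (smul_zero c).symm
        | succ n => exact tensor_smul g c (ξ n) }
    ‖g‖ (by
      intro ξ
      have h := (lp.hasSum_norm (by norm_num : 0 < (2 : ℝ≥0∞).toReal)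
        (⟨creationFun g ξ, memℓp_gen (hasSum_creationFun g ξ).summable⟩ : Fock)).unique
          (hasSum_creationFun g ξ)
      exact ((Real.rpow_left_inj (norm_nonneg _) (by positivity) (by norm_num)).1 h).le)

/-- The left annihilation operator `a⁻(g)`, the adjoint of `a⁺(g)`: it annihilates `Ω` and maps
`f₁ ⊗ f₂ ⊗ ⋯ ⊗ fₙ` to `⟨g, f₁⟩ f₂ ⊗ ⋯ ⊗ fₙ`. -/
def annihilation (g : OneParticle) : Fock →L[ℂ] Fock := ContinuousLinearMap.adjoint (creation g)

/-- The orthogonal projection of the Fock space onto the tensors of length at least one. -/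
def projNonvacuum : Fock →L[ℂ] Fock := 1 - (ℂ ∙ vacuum).starProjection

/-! ### The process -/

/-- The operator `X(g)`: `X(g) Ω = g`, and
`X(g) (f₁ ⊗ ⋯ ⊗ fₙ) = g ⊗ f₁ ⊗ ⋯ ⊗ fₙ + α ⟨g⟩ f₁ ⊗ ⋯ ⊗ fₙ + ⟨g, f₁⟩ f₂ ⊗ ⋯ ⊗ fₙ` for `n ≥ 1`,
where `⟨g⟩ = ∫ g`. It is used for (real-valued) integrable `g`. -/
def field (α : ℝ) (g : OneParticle) : Fock →L[ℂ] Fock :=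
  creation g + annihilation g + ((α : ℂ) * ∫ x, g x ∂halfLine) • projNonvacuum

theorem halfLine_Ico_ne_top (t : ℝ) : halfLine (Set.Ico 0 t) ≠ ∞ :=
  ((Measure.restrict_apply_le _ _).trans_lt measure_Ico_lt_top).ne

/-- `X(t) = X(1_{[0,t)})`. -/
def process (α t : ℝ) : Fock →L[ℂ] Fock :=
  field α (indicatorConstLp 2 measurableSet_Ico (halfLine_Ico_ne_top t) 1)

/-- `C_T = 1 + α X(T)`. -/
def correction (α T : ℝ) : Fock →L[ℂ] Fock := 1 + (α : ℂ) • process α T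

/-! ### Von Neumann algebras and states -/

section States

variable {H : Type*} [NormedAddCommGroup H] [InnerProductSpace ℂ H] [CompleteSpace H]

/-- The von Neumann algebra `W^*(S)` generated by a set `S` of bounded operators: the double
commutant of `S ∪ S^*`. -/
def generatedVN (S : Set (H →L[ℂ] H)) : VonNeumannAlgebra H where
  toStarSubalgebra := StarSubalgebra.centralizer ℂ (StarSubalgebra.centralizer ℂ S : Set _)
  centralizer_centralizer' := by
    change Set.centralizer (Set.centralizer (Set.centralizer _)) = Set.centralizer _
    exact Set.centralizer_centralizer_centralizer _

/-- The ultraweak (σ-weak) topology on `B(H)`: the coarsest topology for which all the functionals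
`A ↦ ∑ n, ⟨ξₙ, A ηₙ⟩` with `∑ ‖ξₙ‖² < ∞` and `∑ ‖ηₙ‖² < ∞` are continuous. -/
@[reducible]
def ultraweak : TopologicalSpace (H →L[ℂ] H) :=
  ⨅ (ξ : lp (fun _ : ℕ => H) 2) (η : lp (fun _ : ℕ => H) 2),
    TopologicalSpace.induced (fun A => ∑' n, ⟪ξ n, A (η n)⟫_ℂ) inferInstance

variable {M : VonNeumannAlgebra H}

/-- A state: a unital positive linear functional. -/
def IsState (f : M.toStarSubalgebra →ₗ[ℂ] ℂ) : Prop :=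
  f 1 = 1 ∧ ∀ a, 0 ≤ (f (star a * a)).re ∧ (f (star a * a)).im = 0

/-- A functional is normal if it is continuous for the ultraweak topology. -/
def IsNormal (f : M.toStarSubalgebra →ₗ[ℂ] ℂ) : Prop :=
  Continuous[TopologicalSpace.induced Subtype.val ultraweak, inferInstance] f

/-- A functional is faithful if it vanishes on no nonzero positive element `a^* a`. -/
def IsFaithful (f : M.toStarSubalgebra →ₗ[ℂ] ℂ) : Prop :=
  ∀ a, f (star a * a) = 0 → a = 0

/-- A functional is tracial if `f (a b) = f (b a)`. -/
def IsTracial (f : M.toStarSubalgebra →ₗ[ℂ] ℂ) : Prop :=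
  ∀ a b, f (a * b) = f (b * a)

end States

/-- `A_T = W^*(X(t) : 0 ≤ t ≤ T)`. -/
def processVN (α T : ℝ) : VonNeumannAlgebra Fock :=
  generatedVN {A | ∃ t ∈ Set.Icc 0 T, A = process α t}

/-- `φ[A] = ⟨Ω, A Ω⟩` on `A_T`. -/
def phi (α T : ℝ) : (processVN α T).toStarSubalgebra →ₗ[ℂ] ℂ where
  toFun A := ⟪vacuum, (A : Fock →L[ℂ] Fock) vacuum⟫_ℂ
  map_add' A B := by simp
  map_smul' c A := by simp

/-- `ψ_T[A] = φ[A C_T] = ⟨Ω, A C_T Ω⟩` on `A_T`. -/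
def psi (α T : ℝ) : (processVN α T).toStarSubalgebra →ₗ[ℂ] ℂ where
  toFun A := ⟪vacuum, ((A : Fock →L[ℂ] Fock) * correction α T) vacuum⟫_ℂ
  map_add' A B := by simp
  map_smul' c A := by simp

end TwoStateFree

end

/-!
Let `h` be a unit vector orthogonal to `L²[0, T)`. The isometry `V = r⁺(h)`, creation at the
rightmost position, keeps every vector away from the vacuum, so on its range each `X(t)` acts as
`V D(t) V*`, where `D(t) = a⁺ + a⁻ + α t` is a free Brownian motion with drift. The operator
`L = 1 + α r⁻(1_{[0,T)})` satisfies `L X(t) = D(t) L`. Hence `V L` commutes with `A_T`, and so does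
`V (r⁺(f) + r⁻(f)) V*` for every real `f`, because left and right semicircular operators commute.

Since `C_T Ω = L* Ω` and `L Ω = Ω`, the functional `ψ_T` is the vector state of `V Ω`. It is tracial
because `X(t) V Ω = Y V Ω` for a self-adjoint `Y` in the commutant. If `A` in `A_T` kills `V Ω`,
then it kills the range of `V`, since `Ω` is cyclic for the right semicircular operators; then
`A L* = L* V* A V = 0`, that is `L A* = 0`, and `L` is injective when `α² T ≤ 1`. Finally, `A Ω = 0`
implies `A V Ω = V L A Ω = 0`.
-/

namespace TwoStateFree

section Measure

variable {X Y E : Type*} [NormedAddCommGroup E] [NormedSpace ℝ E] [CompleteSpace E]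

theorem ae_eq_zero_of_forall_setIntegral_eq_zero_of_isPiSystem [mX : MeasurableSpace X]
    {μ : Measure X} {C : Set (Set X)} (hgen : mX = MeasurableSpace.generateFrom C)
    (hC : IsPiSystem C) {F : X → E} (hF : Integrable F μ) (huniv : ∫ x, F x ∂μ = 0)
    (h : ∀ s ∈ C, ∫ x in s, F x ∂μ = 0) : F =ᵐ[μ] 0 := by
  refine hF.ae_eq_zero_of_forall_setIntegral_eq_zero fun s hs hs_lt => ?_
  clear hs_lt
  induction s, hs using MeasurableSpace.induction_on_inter hgen hC with
  | empty => exact setIntegral_empty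
  | basic s hs => exact h s hs
  | compl s hs ih =>
    rw [setIntegral_compl hs hF, huniv, ih, sub_zero]
  | iUnion s hdisj hs ih =>
    simp only [integral_iUnion hs hdisj hF.integrableOn, ih, tsum_zero]

variable [MeasurableSpace X] [MeasurableSpace Y] {μ : Measure X} {ν : Measure Y}

theorem ae_eq_zero_of_forall_setIntegral_prod_eq_zero [SigmaFinite μ] [SigmaFinite ν]
    {F : X × Y → E}
    (hF : ∀ s t, μ s ≠ ∞ → ν t ≠ ∞ → IntegrableOn F (s ×ˢ t) (μ.prod ν))
    (h : ∀ s t, MeasurableSet s → MeasurableSet t → μ s ≠ ∞ → ν t ≠ ∞ →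
      ∫ z in s ×ˢ t, F z ∂μ.prod ν = 0) :
    F =ᵐ[μ.prod ν] 0 := by
  have hcover : ⋃ p : ℕ × ℕ, spanningSets μ p.1 ×ˢ spanningSets ν p.2 = Set.univ := by
    rw [Set.iUnion_prod, iUnion_spanningSets, iUnion_spanningSets, Set.univ_prod_univ]
  rw [← Measure.restrict_univ (μ := μ.prod ν), ← hcover]
  refine (ae_restrict_iUnion_iff _ _).2 fun ⟨i, j⟩ => ?_
  have hi : MeasurableSet (spanningSets μ i) := measurableSet_spanningSets μ i
  have hj : MeasurableSet (spanningSets ν j) := measurableSet_spanningSets ν j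
  have hμi : μ (spanningSets μ i) ≠ ∞ := (measure_spanningSets_lt_top μ i).ne
  have hνj : ν (spanningSets ν j) ≠ ∞ := (measure_spanningSets_lt_top ν j).ne
  refine ae_eq_zero_of_forall_setIntegral_eq_zero_of_isPiSystem generateFrom_prod.symm
    isPiSystem_prod (hF _ _ hμi hνj) (h _ _ hi hj hμi hνj) ?_
  rintro _ ⟨s, hs, t, ht, rfl⟩
  rw [Measure.restrict_restrict (MeasurableSet.prod hs ht), Set.prod_inter_prod]
  exact h _ _ (MeasurableSet.inter hs hi) (MeasurableSet.inter ht hj)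
    (measure_ne_top_of_subset Set.inter_subset_right hμi)
    (measure_ne_top_of_subset Set.inter_subset_right hνj)

end Measure

section RealElements

variable {X : Type*} [MeasurableSpace X] {μ : Measure X}

theorem isSelfAdjoint_indicatorConstLp_one {s : Set X} (hs : MeasurableSet s) (hμs : μ s ≠ ∞) :
    IsSelfAdjoint (indicatorConstLp 2 hs hμs (1 : ℂ)) := by
  apply Lp.ext
  filter_upwards [Lp.coeFn_star (indicatorConstLp 2 hs hμs (1 : ℂ)),
    indicatorConstLp_coeFn (p := 2) (hs := hs) (hμs := hμs) (c := (1 : ℂ))] with x hstar hx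
  rw [hstar, Pi.star_apply, hx]
  by_cases hxs : x ∈ s <;> simp [hxs]

theorem ae_conj_eq_self {p : ℝ≥0∞} {f : Lp ℂ p μ} (hf : IsSelfAdjoint f) :
    ∀ᵐ x ∂μ, starRingEnd ℂ (f x) = f x := by
  have h := Lp.coeFn_star f
  rw [hf.star_eq] at h
  filter_upwards [h] with x hx
  exact hx.symm

theorem inner_comm_of_isSelfAdjoint {f g : Lp ℂ 2 μ} (hf : IsSelfAdjoint f)
    (hg : IsSelfAdjoint g) : ⟪f, g⟫_ℂ = ⟪g, f⟫_ℂ := by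
  rw [L2.inner_def, L2.inner_def]
  refine integral_congr_ae ?_
  filter_upwards [ae_conj_eq_self hf, ae_conj_eq_self hg] with x hfx hgx
  rw [RCLike.inner_apply', RCLike.inner_apply', hfx, hgx, mul_comm]

theorem conj_integral_of_isSelfAdjoint {p : ℝ≥0∞} {f : Lp ℂ p μ} (hf : IsSelfAdjoint f) :
    starRingEnd ℂ (∫ x, f x ∂μ) = ∫ x, f x ∂μ := by
  rw [← integral_conj]
  exact integral_congr_ae (ae_conj_eq_self hf)

end RealElements

section Tensor

variable {n : ℕ}

/-- The identification `ℝⁿ⁺¹ ≃ ℝ × ℝⁿ` underlying `tensor`, splitting off the coordinate `x 0`. -/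
abbrev headTailEquiv (n : ℕ) : (Fin (n + 1) → ℝ) ≃ᵐ ℝ × (Fin n → ℝ) :=
  MeasurableEquiv.piFinSuccAbove (fun _ => ℝ) 0

theorem measurePreserving_headTailEquiv (n : ℕ) :
    MeasurePreserving (headTailEquiv n) (orthant (n + 1)) (halfLine.prod (orthant n)) :=
  measurePreserving_headTail n

theorem tensor_zero (g : OneParticle) : tensor g (0 : Particles n) = 0 := by
  rw [← norm_eq_zero, norm_tensor, norm_zero, mul_zero]

theorem inner_tensor (g g' : OneParticle) (f f' : Particles n) :
    ⟪tensor g f, tensor g' f'⟫_ℂ = ⟪g, g'⟫_ℂ * ⟪f, f'⟫_ℂ := by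
  rw [L2.inner_def, L2.inner_def, L2.inner_def, ← integral_prod_mul,
    ← (measurePreserving_headTailEquiv n).integral_comp (headTailEquiv n).measurableEmbedding]
  refine integral_congr_ae ?_
  filter_upwards [coeFn_tensor g f, coeFn_tensor g' f'] with x hx hx'
  rw [hx, hx']
  simp only [RCLike.inner_apply, map_mul]
  exact mul_mul_mul_comm _ _ _ _

theorem tensor_indicatorConstLp {s : Set ℝ} {t : Set (Fin n → ℝ)} (hs : MeasurableSet s)
    (ht : MeasurableSet t) (hμs : halfLine s ≠ ∞) (hμt : orthant n t ≠ ∞)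
    (hμst : orthant (n + 1) (headTailEquiv n ⁻¹' s ×ˢ t) ≠ ∞) :
    tensor (indicatorConstLp 2 hs hμs 1) (indicatorConstLp 2 ht hμt 1) =
      indicatorConstLp 2 ((headTailEquiv n).measurable (hs.prod ht)) hμst 1 := by
  have hhead : Measure.QuasiMeasurePreserving (fun x : Fin (n + 1) → ℝ => x 0)
      (orthant (n + 1)) halfLine :=
    Measure.quasiMeasurePreserving_fst.comp (measurePreserving_headTail n).quasiMeasurePreserving
  apply Lp.ext
  filter_upwards [coeFn_tensor (indicatorConstLp 2 hs hμs 1) (indicatorConstLp 2 ht hμt 1),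
    hhead.ae (indicatorConstLp_coeFn (p := 2) (hs := hs) (hμs := hμs) (c := (1 : ℂ))),
    (quasiMeasurePreserving_tail n).ae
      (indicatorConstLp_coeFn (p := 2) (hs := ht) (hμs := hμt) (c := (1 : ℂ))),
    indicatorConstLp_coeFn (p := 2) (hs := (headTailEquiv n).measurable (hs.prod ht))
      (hμs := hμst) (c := (1 : ℂ))] with x htensor hxs hxt hxst
  rw [htensor, hxs, hxt, hxst]
  by_cases hs0 : x 0 ∈ s <;> by_cases ht0 : Fin.tail x ∈ t <;> simp [Set.indicator, hs0, ht0]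

theorem eq_zero_of_forall_inner_tensor_eq_zero {ξ : Particles (n + 1)}
    (h : ∀ g : OneParticle, IsSelfAdjoint g → ∀ f : Particles n, ⟪tensor g f, ξ⟫_ℂ = 0) :
    ξ = 0 := by
  have he := measurePreserving_headTailEquiv n
  have hemb := (headTailEquiv n).measurableEmbedding
  have hcomp : (ξ ∘ (headTailEquiv n).symm) ∘ headTailEquiv n = ξ :=
    funext fun x => congrArg ξ ((headTailEquiv n).symm_apply_apply x)
  have hfinite (s : Set ℝ) (t : Set (Fin n → ℝ)) (hμs : halfLine s ≠ ∞)
      (hμt : orthant n t ≠ ∞) : orthant (n + 1) (headTailEquiv n ⁻¹' s ×ˢ t) ≠ ∞ := by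
    rw [he.measure_preimage_equiv, Measure.prod_prod]
    exact ENNReal.mul_ne_top hμs hμt
  have hzero : ξ ∘ (headTailEquiv n).symm =ᵐ[halfLine.prod (orthant n)] 0 := by
    refine ae_eq_zero_of_forall_setIntegral_prod_eq_zero (fun s t hμs hμt => ?_)
      fun s t hs ht hμs hμt => ?_
    · rw [← he.integrableOn_comp_preimage hemb, hcomp]
      exact integrableOn_Lp_of_measure_ne_top ξ one_le_two (hfinite s t hμs hμt)
    · rw [← he.setIntegral_preimage_emb hemb]
      change ∫ x in _, ((ξ ∘ (headTailEquiv n).symm) ∘ headTailEquiv n) x ∂_ = 0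
      rw [hcomp, ← h _ (isSelfAdjoint_indicatorConstLp_one hs hμs) (indicatorConstLp 2 ht hμt 1),
        tensor_indicatorConstLp hs ht hμs hμt (hfinite s t hμs hμt),
        L2.inner_indicatorConstLp_one]
  rw [Lp.eq_zero_iff_ae_eq_zero, ← hcomp]
  exact he.quasiMeasurePreserving.ae_eq_comp hzero

theorem eq_top_of_forall_tensor_mem {W : Submodule ℂ (Particles (n + 1))}
    (hW : IsClosed (W : Set (Particles (n + 1))))
    (h : ∀ g : OneParticle, IsSelfAdjoint g → ∀ f : Particles n, tensor g f ∈ W) : W = ⊤ := by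
  have : CompleteSpace W := hW.completeSpace_coe
  rw [← Submodule.orthogonal_eq_bot_iff, Submodule.eq_bot_iff]
  exact fun ξ hξ => eq_zero_of_forall_inner_tensor_eq_zero fun g hg f => hξ _ (h g hg f)

end Tensor

section Reversal

variable (n : ℕ)

theorem measurePreserving_comp_rev :
    MeasurePreserving (fun x : Fin n → ℝ => x ∘ Fin.rev) (orthant n) (orthant n) :=
  measurePreserving_arrowCongr' _ _ Fin.revPerm (.refl ℝ) fun _ => .id halfLine

/-- Reversal `f₁ ⊗ ⋯ ⊗ fₙ ↦ fₙ ⊗ ⋯ ⊗ f₁` of the order of the factors on `L²(ℝ₊)^{⊗ n}`. -/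
noncomputable def reverseParticles : Particles n →ₗᵢ[ℂ] Particles n :=
  Lp.compMeasurePreservingₗᵢ ℂ _ (measurePreserving_comp_rev n)

variable {n}

theorem coeFn_reverseParticles (f : Particles n) :
    reverseParticles n f =ᵐ[orthant n] fun x => f (x ∘ Fin.rev) :=
  Lp.coeFn_compMeasurePreserving f (measurePreserving_comp_rev n)

theorem reverseParticles_reverseParticles (f : Particles n) :
    reverseParticles n (reverseParticles n f) = f := by
  apply Lp.ext
  filter_upwards [coeFn_reverseParticles (reverseParticles n f),
    (measurePreserving_comp_rev n).quasiMeasurePreserving.ae (coeFn_reverseParticles f)]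
    with x hx hx_rev
  rw [hx, hx_rev, Function.comp_assoc, Fin.rev_involutive.comp_self, Function.comp_id]

theorem reverseParticles_of_le_one (hn : n ≤ 1) (f : Particles n) : reverseParticles n f = f := by
  have := Fin.subsingleton_iff_le_one.2 hn
  apply Lp.ext
  filter_upwards [coeFn_reverseParticles f] with x hx
  rw [hx, Subsingleton.elim (Fin.rev : Fin n → Fin n) id, Function.comp_id]

/-- The tensor `f ⊗ h`, with the new factor on the right. -/
noncomputable def tensorRight (f : Particles n) (h : OneParticle) : Particles (n + 1) :=
  reverseParticles (n + 1) (tensor h (reverseParticles n f))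

theorem tail_comp_rev (x : Fin (n + 1) → ℝ) :
    Fin.tail (x ∘ Fin.rev) = Fin.init x ∘ Fin.rev := by
  funext i
  simp only [Fin.tail, Fin.init, Function.comp_apply, Fin.rev_succ]

theorem quasiMeasurePreserving_init :
    Measure.QuasiMeasurePreserving (fun x : Fin (n + 1) → ℝ => Fin.init x)
      (orthant (n + 1)) (orthant n) := by
  have h := (measurePreserving_comp_rev n).quasiMeasurePreserving.comp
    ((quasiMeasurePreserving_tail n).comp (measurePreserving_comp_rev _).quasiMeasurePreserving)
  convert h using 1
  funext x
  simp only [Function.comp_apply, tail_comp_rev, Function.comp_assoc,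
    Fin.rev_involutive.comp_self, Function.comp_id]

theorem coeFn_tensorRight (f : Particles n) (h : OneParticle) :
    tensorRight f h =ᵐ[orthant (n + 1)] fun x => f (Fin.init x) * h (x (Fin.last n)) := by
  filter_upwards [coeFn_reverseParticles (tensor h (reverseParticles n f)),
    (measurePreserving_comp_rev _).quasiMeasurePreserving.ae
      (coeFn_tensor h (reverseParticles n f)),
    (measurePreserving_comp_rev _).quasiMeasurePreserving.ae
      ((quasiMeasurePreserving_tail n).ae (coeFn_reverseParticles f))] with x hrev htensor htail
  rw [tensorRight, hrev, htensor, htail, tail_comp_rev, Function.comp_assoc,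
    Fin.rev_involutive.comp_self, Function.comp_id, Function.comp_apply, Fin.rev_zero, mul_comm]

theorem tensorRight_tensor (g h : OneParticle) (f : Particles n) :
    tensorRight (tensor g f) h = tensor g (tensorRight f h) := by
  apply Lp.ext
  filter_upwards [coeFn_tensorRight (tensor g f) h,
    quasiMeasurePreserving_init.ae (coeFn_tensor g f), coeFn_tensor g (tensorRight f h),
    (quasiMeasurePreserving_tail _).ae (coeFn_tensorRight f h)] with x hr hrl hl hlr
  rw [hr, hrl, hl, hlr, Fin.tail_init_eq_init_tail, mul_assoc]
  rfl

end Reversal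

section FockSpace

variable {n : ℕ}

theorem orthant_zero : orthant 0 = Measure.dirac default := by
  rw [orthant, Measure.pi_of_empty _ default]

theorem norm_vacuum : ‖vacuum‖ = 1 := by
  rw [vacuum, lp.norm_single two_pos, Lp.norm_toLp, orthant_zero,
    eLpNorm_const _ two_ne_zero (NeZero.ne _)]
  simp

theorem inner_vacuum_vacuum : ⟪vacuum, vacuum⟫_ℂ = 1 :=
  inner_self_eq_one_of_norm_eq_one norm_vacuum

theorem single_zero_eq_smul_vacuum (f : Particles 0) :
    (lp.single 2 0 f : Fock) = f 0 • vacuum := by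
  rw [vacuum, ← lp.single_smul]
  congr 1
  apply Lp.ext
  filter_upwards [Lp.coeFn_smul (f 0) (memLp_one_orthant_zero.toLp _),
    memLp_one_orthant_zero.coeFn_toLp] with x hsmul hone
  rw [hsmul, Pi.smul_apply, hone, smul_eq_mul, mul_one, Subsingleton.elim x 0]

theorem creation_apply_zero (g : OneParticle) (ξ : Fock) : creation g ξ 0 = 0 := rfl

theorem creation_apply_succ (g : OneParticle) (ξ : Fock) (n : ℕ) :
    creation g ξ (n + 1) = tensor g (ξ n) := rfl

theorem creation_single (g : OneParticle) (f : Particles n) :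
    creation g (lp.single 2 n f) = lp.single 2 (n + 1) (tensor g f) := by
  ext1
  funext m
  rcases m with _ | m
  · rw [creation_apply_zero, lp.single_apply_ne _ _ _ n.succ_ne_zero.symm]
  · rw [creation_apply_succ]
    rcases eq_or_ne m n with rfl | hm
    · rw [lp.single_apply_self, lp.single_apply_self]
    · rw [lp.single_apply_ne _ _ _ hm, lp.single_apply_ne _ _ _ (by simpa using hm), tensor_zero]

theorem inner_creation_creation (g g' : OneParticle) (ξ η : Fock) :
    ⟪creation g ξ, creation g' η⟫_ℂ = ⟪g, g'⟫_ℂ * ⟪ξ, η⟫_ℂ := by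
  have hsum : Summable fun n => ⟪creation g ξ n, creation g' η n⟫_ℂ := lp.summable_inner _ _
  rw [lp.inner_eq_tsum, lp.inner_eq_tsum, hsum.tsum_eq_zero_add, creation_apply_zero,
    inner_zero_left, zero_add, ← tsum_mul_left]
  exact tsum_congr fun n => inner_tensor g g' (ξ n) (η n)

theorem star_creation (g : OneParticle) : star (creation g) = annihilation g := rfl

theorem star_annihilation (g : OneParticle) : star (annihilation g) = creation g :=
  star_star (creation g)

theorem inner_annihilation_right (g : OneParticle) (ξ η : Fock) :
    ⟪ξ, annihilation g η⟫_ℂ = ⟪creation g ξ, η⟫_ℂ :=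
  ContinuousLinearMap.adjoint_inner_right _ _ _

theorem annihilation_creation (g g' : OneParticle) (ξ : Fock) :
    annihilation g (creation g' ξ) = ⟪g, g'⟫_ℂ • ξ := by
  refine ext_inner_left ℂ fun ζ => ?_
  rw [inner_annihilation_right, inner_creation_creation, inner_smul_right]

theorem inner_vacuum_creation (g : OneParticle) (ξ : Fock) : ⟪vacuum, creation g ξ⟫_ℂ = 0 := by
  rw [vacuum, lp.inner_single_left, creation_apply_zero, inner_zero_right]

theorem annihilation_vacuum (g : OneParticle) : annihilation g vacuum = 0 := by
  refine ext_inner_left ℂ fun ζ => ?_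
  rw [inner_annihilation_right, ← inner_conj_symm, inner_vacuum_creation, map_zero,
    inner_zero_right]

theorem norm_annihilation_apply_le (g : OneParticle) (ξ : Fock) (n : ℕ) :
    ‖annihilation g ξ n‖ ≤ ‖g‖ * ‖ξ (n + 1)‖ := by
  set ζ := annihilation g ξ n with hζ
  have hinner : ⟪ζ, ζ⟫_ℂ = ⟪tensor g ζ, ξ (n + 1)⟫_ℂ := by
    nth_rw 2 [hζ]
    rw [← lp.inner_single_left (G := Particles), inner_annihilation_right, creation_single,
      lp.inner_single_left]
  rcases eq_or_ne ζ 0 with h0 | h0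
  · rw [h0, norm_zero]
    positivity
  · refine le_of_mul_le_mul_right ?_ (norm_pos_iff.2 h0)
    calc ‖ζ‖ * ‖ζ‖ = ‖⟪tensor g ζ, ξ (n + 1)⟫_ℂ‖ := by
          rw [← hinner, inner_self_eq_norm_sq_to_K, norm_pow, RCLike.norm_ofReal, abs_norm, sq]
      _ ≤ ‖tensor g ζ‖ * ‖ξ (n + 1)‖ := norm_inner_le_norm _ _
      _ = ‖g‖ * ‖ξ (n + 1)‖ * ‖ζ‖ := by rw [norm_tensor, mul_right_comm]

theorem tendsto_norm_apply_atTop (ξ : Fock) :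
    Filter.Tendsto (fun n => ‖ξ n‖) Filter.atTop (𝓝 0) := by
  have h := ((lp.memℓp ξ).summable two_pos).tendsto_atTop_zero.sqrt
  simpa [Real.sqrt_sq] using h

theorem injective_one_add_smul_annihilation {g : OneParticle} {c : ℂ} (hg : ‖c‖ * ‖g‖ ≤ 1) :
    Function.Injective (1 + c • annihilation g : Fock →L[ℂ] Fock) := by
  refine (injective_iff_map_eq_zero _).2 fun ξ hξ => ?_
  have hfix : ξ = -(c • annihilation g ξ) := eq_neg_of_add_eq_zero_left hξ
  have hmono : Monotone fun n => ‖ξ n‖ := monotone_nat_of_le_succ fun n =>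
    calc ‖ξ n‖ = ‖(-(c • annihilation g ξ) : Fock) n‖ := by rw [← hfix]
      _ = ‖c‖ * ‖annihilation g ξ n‖ := by
          rw [lp.coeFn_neg, Pi.neg_apply, norm_neg, lp.coeFn_smul, Pi.smul_apply, norm_smul]
      _ ≤ ‖c‖ * (‖g‖ * ‖ξ (n + 1)‖) := by gcongr; exact norm_annihilation_apply_le g ξ n
      _ ≤ ‖ξ (n + 1)‖ := by
          rw [← mul_assoc]
          exact mul_le_of_le_one_left (norm_nonneg _) hg
  ext1
  funext n
  exact norm_le_zero_iff.1 (hmono.ge_of_tendsto (tendsto_norm_apply_atTop ξ) n)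

theorem eq_top_of_creation_single_mem {Z : Submodule ℂ Fock} (hZ : IsClosed (Z : Set Fock))
    (hvac : vacuum ∈ Z)
    (hstep : ∀ n, (∀ k ≤ n, ∀ f : Particles k, lp.single 2 k f ∈ Z) →
      ∀ g : OneParticle, IsSelfAdjoint g → ∀ f : Particles n,
        creation g (lp.single 2 n f) ∈ Z) : Z = ⊤ := by
  have hsingle (n : ℕ) : ∀ f : Particles n, lp.single 2 n f ∈ Z := by
    induction n using Nat.strong_induction_on with | _ n ih
    rcases n with _ | n
    · intro f
      rw [single_zero_eq_smul_vacuum]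
      exact Z.smul_mem _ hvac
    · have htop : Z.comap (lp.singleContinuousLinearMap ℂ Particles 2 (n + 1)).toLinearMap = ⊤ :=
        eq_top_of_forall_tensor_mem (hZ.preimage (ContinuousLinearMap.continuous _))
          fun g hg f => by
            change lp.single 2 (n + 1) (tensor g f) ∈ Z
            rw [← creation_single]
            exact hstep n (fun k hk => ih k (Nat.lt_succ_of_le hk)) g hg f
      exact fun f => Submodule.eq_top_iff'.1 htop f
  rw [Submodule.eq_top_iff']
  exact fun ξ => hZ.mem_of_tendsto (lp.hasSum_single ENNReal.ofNat_ne_top ξ)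
    (.of_forall fun s => Z.sum_mem fun n _ => hsingle n (ξ n))

theorem annihilation_single_mem {Z : Submodule ℂ Fock} (hZ : IsClosed (Z : Set Fock))
    (h : ∀ f : Particles n, lp.single 2 n f ∈ Z) (g : OneParticle) (f : Particles (n + 1)) :
    annihilation g (lp.single 2 (n + 1) f) ∈ Z := by
  let A := annihilation g ∘L lp.singleContinuousLinearMap ℂ Particles 2 (n + 1)
  have htop : Z.comap A.toLinearMap = ⊤ :=
    eq_top_of_forall_tensor_mem (hZ.preimage A.continuous) fun g' _ f' => by
      change annihilation g (lp.single 2 (n + 1) (tensor g' f')) ∈ Z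
      rw [← creation_single, annihilation_creation]
      exact Z.smul_mem _ (h f')
  exact Submodule.eq_top_iff'.1 htop f

theorem eq_top_of_semicircular_mem {Z : Submodule ℂ Fock} (hZ : IsClosed (Z : Set Fock))
    (hvac : vacuum ∈ Z)
    (h : ∀ g : OneParticle, IsSelfAdjoint g → ∀ ξ ∈ Z, (creation g + annihilation g) ξ ∈ Z) :
    Z = ⊤ := by
  refine eq_top_of_creation_single_mem hZ hvac fun n hsingle g hg f => ?_
  have hann : annihilation g (lp.single 2 n f) ∈ Z := by
    rcases n with _ | n
    · rw [single_zero_eq_smul_vacuum, map_smul, annihilation_vacuum, smul_zero]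
      exact Z.zero_mem
    · exact annihilation_single_mem hZ (hsingle n n.le_succ) g f
  have hsum := h g hg _ (hsingle n le_rfl f)
  exact (Z.add_mem_iff_left hann).1 hsum

theorem ext_creation {A B : Fock →L[ℂ] Fock} (hvac : A vacuum = B vacuum)
    (hcreation : ∀ g ξ, A (creation g ξ) = B (creation g ξ)) : A = B := by
  have htop : A.toLinearMap.eqLocus B.toLinearMap = ⊤ :=
    eq_top_of_creation_single_mem (isClosed_eq A.continuous B.continuous) hvac
      fun n _ g _ f => hcreation g _
  exact ContinuousLinearMap.coe_injective (LinearMap.eqLocus_eq_top.1 htop)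

end FockSpace

section RightOperators

theorem hasSum_norm_reverseParticles (ξ : Fock) :
    HasSum (fun n => ‖reverseParticles n (ξ n)‖ ^ (2 : ℝ≥0∞).toReal)
      (‖ξ‖ ^ (2 : ℝ≥0∞).toReal) := by
  simpa only [LinearIsometry.norm_map] using lp.hasSum_norm two_pos ξ

/-- Reversal of the order of the tensor factors on the Fock space. It conjugates operators acting
on the leftmost factor into operators acting on the rightmost one. -/
noncomputable def reversal : Fock →ₗᵢ[ℂ] Fock where
  toFun ξ := ⟨fun n => reverseParticles n (ξ n),
    memℓp_gen (hasSum_norm_reverseParticles ξ).summable⟩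
  map_add' ξ η := by
    ext1
    funext n
    exact map_add (reverseParticles n) (ξ n) (η n)
  map_smul' c ξ := by
    ext1
    funext n
    exact map_smul (reverseParticles n) c (ξ n)
  norm_map' ξ := (Real.rpow_left_inj (norm_nonneg _) (norm_nonneg _) two_ne_zero).1
    ((lp.hasSum_norm two_pos _).unique (hasSum_norm_reverseParticles ξ))

theorem reversal_apply (ξ : Fock) (n : ℕ) : reversal ξ n = reverseParticles n (ξ n) := rfl

theorem reversal_reversal (ξ : Fock) : reversal (reversal ξ) = ξ := by
  ext1
  funext n
  exact reverseParticles_reverseParticles (ξ n)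

theorem reversal_single_of_le_one {n : ℕ} (hn : n ≤ 1) (f : Particles n) :
    reversal (lp.single 2 n f) = lp.single 2 n f := by
  ext1
  funext m
  rw [reversal_apply]
  rcases eq_or_ne m n with rfl | hm
  · exact reverseParticles_of_le_one hn _
  · rw [lp.single_apply_ne _ _ _ hm, map_zero]

theorem reversal_vacuum : reversal vacuum = vacuum :=
  reversal_single_of_le_one zero_le_one _

theorem inner_reversal_left (ξ η : Fock) : ⟪reversal ξ, η⟫_ℂ = ⟪ξ, reversal η⟫_ℂ := by
  rw [← reversal.inner_map_map ξ (reversal η), reversal_reversal]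

/-- The right creation operator `r⁺(h) : f₁ ⊗ ⋯ ⊗ fₙ ↦ f₁ ⊗ ⋯ ⊗ fₙ ⊗ h`, `Ω ↦ h`. -/
noncomputable def rightCreation (h : OneParticle) : Fock →L[ℂ] Fock :=
  reversal.toContinuousLinearMap * creation h * reversal.toContinuousLinearMap

/-- The right annihilation operator `r⁻(h)`, the adjoint of `r⁺(h)`. -/
noncomputable def rightAnnihilation (h : OneParticle) : Fock →L[ℂ] Fock := star (rightCreation h)

theorem rightCreation_apply (h : OneParticle) (ξ : Fock) :
    rightCreation h ξ = reversal (creation h (reversal ξ)) := rfl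

theorem star_rightCreation (h : OneParticle) : star (rightCreation h) = rightAnnihilation h := rfl

theorem star_rightAnnihilation (h : OneParticle) : star (rightAnnihilation h) = rightCreation h :=
  star_star _

theorem inner_rightAnnihilation_right (h : OneParticle) (ξ η : Fock) :
    ⟪ξ, rightAnnihilation h η⟫_ℂ = ⟪rightCreation h ξ, η⟫_ℂ :=
  ContinuousLinearMap.adjoint_inner_right _ _ _

theorem rightAnnihilation_apply (h : OneParticle) (ξ : Fock) :
    rightAnnihilation h ξ = reversal (annihilation h (reversal ξ)) := by
  refine ext_inner_left ℂ fun ζ => ?_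
  rw [inner_rightAnnihilation_right, rightCreation_apply, inner_reversal_left,
    ← inner_annihilation_right, inner_reversal_left]

theorem rightCreation_vacuum (h : OneParticle) : rightCreation h vacuum = creation h vacuum := by
  rw [rightCreation_apply, reversal_vacuum, vacuum, creation_single,
    reversal_single_of_le_one le_rfl]

theorem rightAnnihilation_vacuum (h : OneParticle) : rightAnnihilation h vacuum = 0 := by
  rw [rightAnnihilation_apply, reversal_vacuum, annihilation_vacuum, map_zero]

theorem rightAnnihilation_mul_rightCreation (h h' : OneParticle) :
    rightAnnihilation h * rightCreation h' = ⟪h, h'⟫_ℂ • 1 := by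
  ext1 ξ
  change rightAnnihilation h (rightCreation h' ξ) = ⟪h, h'⟫_ℂ • ξ
  rw [rightAnnihilation_apply, rightCreation_apply, reversal_reversal, annihilation_creation,
    map_smul, reversal_reversal]

theorem injective_one_add_smul_rightAnnihilation {h : OneParticle} {c : ℂ}
    (hh : ‖c‖ * ‖h‖ ≤ 1) :
    Function.Injective (1 + c • rightAnnihilation h : Fock →L[ℂ] Fock) := by
  have hconj : ⇑(1 + c • rightAnnihilation h : Fock →L[ℂ] Fock) =
      reversal ∘ (1 + c • annihilation h : Fock →L[ℂ] Fock) ∘ reversal := by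
    funext ξ
    simp [rightAnnihilation_apply, reversal_reversal]
  rw [hconj]
  exact reversal.injective.comp
    ((injective_one_add_smul_annihilation hh).comp reversal.injective)

theorem commute_creation_rightCreation (g h : OneParticle) :
    Commute (creation g) (rightCreation h) := by
  ext1 ξ
  ext1
  funext n
  rcases n with _ | _ | n
  · exact (map_zero (reverseParticles 0)).symm
  · change tensor g (reverseParticles 0 0) = tensorRight 0 h
    rw [tensorRight, map_zero, tensor_zero, tensor_zero, map_zero]
  · exact (tensorRight_tensor g h (ξ n)).symm

theorem commute_annihilation_rightAnnihilation (g h : OneParticle) :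
    Commute (annihilation g) (rightAnnihilation h) :=
  (commute_creation_rightCreation g h).star_star

theorem projNonvacuum_apply (ξ : Fock) : projNonvacuum ξ = ξ - ⟪vacuum, ξ⟫_ℂ • vacuum := by
  rw [projNonvacuum, sub_apply, one_apply_eq_self,
    Submodule.starProjection_unit_singleton ℂ norm_vacuum]

theorem projNonvacuum_vacuum : projNonvacuum vacuum = 0 := by
  rw [projNonvacuum_apply, inner_vacuum_vacuum, one_smul, sub_self]

theorem projNonvacuum_creation (g : OneParticle) (ξ : Fock) :
    projNonvacuum (creation g ξ) = creation g ξ := by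
  rw [projNonvacuum_apply, inner_vacuum_creation, zero_smul, sub_zero]

theorem isSelfAdjoint_projNonvacuum : IsSelfAdjoint projNonvacuum :=
  (IsSelfAdjoint.one _).sub isStarProjection_starProjection.isSelfAdjoint

theorem projNonvacuum_mul_rightCreation (h : OneParticle) :
    projNonvacuum * rightCreation h = rightCreation h := by
  ext1 ξ
  change projNonvacuum (rightCreation h ξ) = _
  rw [projNonvacuum_apply, ← reversal_vacuum, rightCreation_apply, reversal.inner_map_map,
    inner_vacuum_creation, zero_smul, sub_zero]

theorem rightAnnihilation_mul_projNonvacuum (h : OneParticle) :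
    rightAnnihilation h * projNonvacuum = rightAnnihilation h := by
  rw [← star_inj, star_mul, isSelfAdjoint_projNonvacuum, star_rightAnnihilation,
    projNonvacuum_mul_rightCreation]

theorem annihilation_mul_rightCreation (g h : OneParticle) :
    annihilation g * rightCreation h =
      rightCreation h * annihilation g + ⟪g, h⟫_ℂ • (1 - projNonvacuum) := by
  have hcomm (g' : OneParticle) (ξ : Fock) :
      rightCreation h (creation g' ξ) = creation g' (rightCreation h ξ) :=
    (DFunLike.congr_fun (commute_creation_rightCreation g' h) ξ).symm
  refine ext_creation ?_ fun g' ξ => ?_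
  · simp [rightCreation_vacuum, annihilation_creation, annihilation_vacuum, projNonvacuum_vacuum]
  · simp [hcomm, annihilation_creation, projNonvacuum_creation]

theorem rightAnnihilation_mul_creation (g h : OneParticle) :
    rightAnnihilation h * creation g =
      creation g * rightAnnihilation h + ⟪h, g⟫_ℂ • (1 - projNonvacuum) := by
  simpa [star_creation, star_annihilation, star_rightCreation,
    isSelfAdjoint_projNonvacuum.star_eq] using congrArg star (annihilation_mul_rightCreation g h)

/-- The right semicircular operator `r⁺(f) + r⁻(f)`. -/
noncomputable def rightField (f : OneParticle) : Fock →L[ℂ] Fock :=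
  rightCreation f + rightAnnihilation f

theorem isSelfAdjoint_rightField (f : OneParticle) : IsSelfAdjoint (rightField f) :=
  IsSelfAdjoint.add_star_self (rightCreation f)

theorem rightField_vacuum (f : OneParticle) : rightField f vacuum = creation f vacuum := by
  rw [rightField, add_apply, rightCreation_vacuum, rightAnnihilation_vacuum, add_zero]

theorem eq_top_of_rightField_mem {Z : Submodule ℂ Fock} (hZ : IsClosed (Z : Set Fock))
    (hvac : vacuum ∈ Z)
    (h : ∀ f : OneParticle, IsSelfAdjoint f → ∀ ξ ∈ Z, rightField f ξ ∈ Z) : Z = ⊤ := by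
  have htop : Z.comap reversal.toLinearMap = ⊤ := by
    refine eq_top_of_semicircular_mem (hZ.preimage reversal.continuous) ?_ fun g hg ξ hξ => ?_
    · change reversal vacuum ∈ Z
      rwa [reversal_vacuum]
    · have hmem := h g hg (reversal ξ) hξ
      rwa [rightField, add_apply, rightCreation_apply, rightAnnihilation_apply, reversal_reversal,
        ← map_add] at hmem
  refine Submodule.eq_top_iff'.2 fun ξ => ?_
  rw [← reversal_reversal ξ]
  exact Submodule.eq_top_iff'.1 htop (reversal ξ)

end RightOperators

section Intertwining

/-- The operator `a⁺(g) + a⁻(g) + α ⟨g⟩`: on all vectors, including the vacuum, it acts as `X(g)`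
does on nonvacuum vectors. Its values at the `1_{[0,t)}` form a free Brownian motion with drift. -/
noncomputable def driftedField (α : ℝ) (g : OneParticle) : Fock →L[ℂ] Fock :=
  creation g + annihilation g + ((α : ℂ) * ∫ x, g x ∂halfLine) • 1

variable {α : ℝ} {g : OneParticle}

theorem field_vacuum (α : ℝ) (g : OneParticle) : field α g vacuum = creation g vacuum := by
  rw [field, add_apply, add_apply, smul_apply, annihilation_vacuum, projNonvacuum_vacuum,
    smul_zero, add_zero, add_zero]

theorem isSelfAdjoint_drift (α : ℝ) (hg : IsSelfAdjoint g) :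
    IsSelfAdjoint ((α : ℂ) * ∫ x, g x ∂halfLine) := by
  rw [isSelfAdjoint_iff, RCLike.star_def, map_mul, Complex.conj_ofReal,
    conj_integral_of_isSelfAdjoint hg]

theorem isSelfAdjoint_field (α : ℝ) (hg : IsSelfAdjoint g) : IsSelfAdjoint (field α g) :=
  .add (.add_star_self (creation g)) ((isSelfAdjoint_drift α hg).smul isSelfAdjoint_projNonvacuum)

theorem isSelfAdjoint_driftedField (α : ℝ) (hg : IsSelfAdjoint g) :
    IsSelfAdjoint (driftedField α g) :=
  .add (.add_star_self (creation g)) ((isSelfAdjoint_drift α hg).smul (.one _))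

theorem field_mul_rightCreation {h : OneParticle} (α : ℝ) (hgh : ⟪g, h⟫_ℂ = 0) :
    field α g * rightCreation h = rightCreation h * driftedField α g := by
  simp only [field, driftedField, add_mul, mul_add, smul_mul_assoc, mul_smul_comm, mul_one,
    projNonvacuum_mul_rightCreation, annihilation_mul_rightCreation,
    (commute_creation_rightCreation g h).eq, hgh, zero_smul, add_zero]

theorem rightAnnihilation_mul_field {h : OneParticle} (α : ℝ) (hg : IsSelfAdjoint g)
    (hgh : ⟪g, h⟫_ℂ = 0) :
    rightAnnihilation h * field α g = driftedField α g * rightAnnihilation h := by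
  simpa only [star_mul, star_rightCreation, (isSelfAdjoint_field α hg).star_eq,
    (isSelfAdjoint_driftedField α hg).star_eq] using
    congrArg star (field_mul_rightCreation α hgh)

theorem one_add_smul_rightAnnihilation_mul_field {u : OneParticle} (α : ℝ)
    (hu : ⟪u, g⟫_ℂ = ∫ x, g x ∂halfLine) :
    (1 + (α : ℂ) • rightAnnihilation u) * field α g =
      driftedField α g * (1 + (α : ℂ) • rightAnnihilation u) := by
  simp only [field, driftedField, add_mul, mul_add, smul_mul_assoc, mul_smul_comm, one_mul,
    mul_one, rightAnnihilation_mul_projNonvacuum, rightAnnihilation_mul_creation,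
    (commute_annihilation_rightAnnihilation g u).eq, ← hu]
  module

theorem commute_driftedField_rightField {f : OneParticle} (α : ℝ) (hgf : ⟪g, f⟫_ℂ = ⟪f, g⟫_ℂ) :
    Commute (driftedField α g) (rightField f) := by
  simp only [Commute, SemiconjBy, driftedField, rightField, add_mul, mul_add, smul_mul_assoc,
    mul_smul_comm, one_mul, mul_one, rightAnnihilation_mul_creation,
    annihilation_mul_rightCreation, (commute_annihilation_rightAnnihilation g f).eq,
    (commute_creation_rightCreation g f).eq, hgf]
  module

theorem commute_field_rightCreation_mul {u h : OneParticle} (α : ℝ) (hgh : ⟪g, h⟫_ℂ = 0)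
    (hu : ⟪u, g⟫_ℂ = ∫ x, g x ∂halfLine) :
    Commute (field α g) (rightCreation h * (1 + (α : ℂ) • rightAnnihilation u)) := by
  rw [Commute, SemiconjBy, ← mul_assoc, field_mul_rightCreation α hgh, mul_assoc, mul_assoc,
    one_add_smul_rightAnnihilation_mul_field α hu]

theorem commute_field_rightCreation_rightField {f h : OneParticle} (α : ℝ)
    (hg : IsSelfAdjoint g) (hf : IsSelfAdjoint f) (hgh : ⟪g, h⟫_ℂ = 0) :
    Commute (field α g) (rightCreation h * rightField f * rightAnnihilation h) := by
  have hcomm := commute_driftedField_rightField α (inner_comm_of_isSelfAdjoint hg hf)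
  rw [Commute, SemiconjBy, mul_assoc _ _ (field α g), rightAnnihilation_mul_field α hg hgh,
    ← mul_assoc, ← mul_assoc, field_mul_rightCreation α hgh, mul_assoc _ _ (rightField f),
    hcomm.eq]
  simp only [mul_assoc]

end Intertwining

section VonNeumann

variable {H : Type*} [NormedAddCommGroup H] [InnerProductSpace ℂ H] [CompleteSpace H]

theorem inner_star_apply_left (A : H →L[ℂ] H) (x y : H) : ⟪star A x, y⟫_ℂ = ⟪x, A y⟫_ℂ :=
  A.adjoint_inner_left y x

theorem inner_star_apply_right (A : H →L[ℂ] H) (x y : H) : ⟪x, star A y⟫_ℂ = ⟪A x, y⟫_ℂ :=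
  A.adjoint_inner_right x y

theorem inner_apply_comm_of_isSelfAdjoint {A : H →L[ℂ] H} (hA : IsSelfAdjoint A) (x y : H) :
    ⟪x, A y⟫_ℂ = ⟪A x, y⟫_ℂ := by
  rw [← inner_star_apply_right, hA.star_eq]

theorem apply_comm_of_mem_commutant {M : VonNeumannAlgebra H} {A Y : H →L[ℂ] H} (hA : A ∈ M)
    (hY : Y ∈ M.commutant) (ξ : H) : A (Y ξ) = Y (A ξ) :=
  DFunLike.congr_fun (VonNeumannAlgebra.mem_commutant_iff.1 hY A hA) ξ

section Generated

variable {S : Set (H →L[ℂ] H)}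

theorem mem_generatedVN_of_mem {X : H →L[ℂ] H} (hX : X ∈ S) : X ∈ generatedVN S :=
  (StarSubalgebra.mem_centralizer_iff ℂ).2 fun _ hY =>
    ⟨((StarSubalgebra.mem_centralizer_iff ℂ).1 hY X hX).1.symm,
      ((StarSubalgebra.mem_centralizer_iff ℂ).1 (star_mem hY) X hX).1.symm⟩

theorem mem_commutant_generatedVN (hS : ∀ X ∈ S, IsSelfAdjoint X) {Y : H →L[ℂ] H}
    (hY : ∀ X ∈ S, Commute X Y) : Y ∈ (generatedVN S).commutant := by
  have hYS : Y ∈ StarSubalgebra.centralizer ℂ S :=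
    (StarSubalgebra.mem_centralizer_iff ℂ).2 fun X hX =>
      ⟨hY X hX, by rw [(hS X hX).star_eq, (hY X hX).eq]⟩
  exact VonNeumannAlgebra.mem_commutant_iff.2 fun A hA =>
    ((StarSubalgebra.mem_centralizer_iff ℂ).1 hA Y hYS).1.symm

theorem apply_mem_of_mem_generatedVN (hS : ∀ X ∈ S, IsSelfAdjoint X) {F : Submodule ℂ H}
    (hF : IsClosed (F : Set H)) (hinv : ∀ X ∈ S, ∀ ξ ∈ F, X ξ ∈ F) {A : H →L[ℂ] H}
    (hA : A ∈ generatedVN S) {ξ : H} (hξ : ξ ∈ F) : A ξ ∈ F := by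
  have : CompleteSpace F := hF.completeSpace_coe
  have hcomm : ∀ X ∈ S, Commute X F.starProjection := fun X hX => by
    ext1 ζ
    refine (Submodule.eq_starProjection_of_mem_of_inner_eq_zero
      (hinv X hX _ (F.starProjection_apply_mem ζ)) fun η hη => ?_).symm
    change ⟪X ζ - X (F.starProjection ζ), η⟫_ℂ = 0
    rw [← map_sub, ← inner_apply_comm_of_isSelfAdjoint (hS X hX)]
    exact Submodule.starProjection_inner_eq_zero ζ (X η) (hinv X hX η hη)
  have hproj := apply_comm_of_mem_commutant hA (mem_commutant_generatedVN hS hcomm) ξ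
  rw [Submodule.starProjection_eq_self_iff.2 hξ] at hproj
  rw [hproj]
  exact F.starProjection_apply_mem _

end Generated

section Trace

variable {M : VonNeumannAlgebra H} {S : Set (H →L[ℂ] H)} {v : H} {A B P : H →L[ℂ] H}

/-- The centralizer in `M` of the vector functional `A ↦ ⟪v, A v⟫`: the elements `P` of `M` for
which `A P` and `P A` have the same value for every `A` in `M`. -/
noncomputable def vectorStateCentralizer (M : VonNeumannAlgebra H) (v : H) :
    StarSubalgebra ℂ (H →L[ℂ] H) where
  carrier := {P | P ∈ M ∧ ∀ A ∈ M, ⟪v, A (P v)⟫_ℂ = ⟪v, P (A v)⟫_ℂ}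
  mul_mem' := fun {P Q} hP hQ => ⟨mul_mem hP.1 hQ.1, fun A hA =>
    (hQ.2 (A * P) (mul_mem hA hP.1)).trans (hP.2 (Q * A) (mul_mem hQ.1 hA))⟩
  algebraMap_mem' := fun c => ⟨M.algebraMap_mem c, fun A _ =>
    congrArg (inner ℂ v) (A.map_smul c v)⟩
  add_mem' := fun {P Q} hP hQ => ⟨add_mem hP.1 hQ.1, fun A hA => by
    simp only [add_apply, map_add, inner_add_right, hP.2 A hA, hQ.2 A hA]⟩
  star_mem' := fun {P} hP => ⟨star_mem hP.1, fun A hA => by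
    rw [← inner_star_apply_left, ← inner_conj_symm, inner_star_apply_left,
      ← hP.2 _ (star_mem hA), inner_star_apply_right, inner_conj_symm, inner_star_apply_right]⟩

theorem inner_star_apply_eq_of_mem_vectorStateCentralizer (hP : P ∈ vectorStateCentralizer M v)
    (hA : A ∈ M) : ⟪star A v, P v⟫_ℂ = ⟪star P v, A v⟫_ℂ := by
  rw [inner_star_apply_left, inner_star_apply_left, hP.2 A hA]

theorem norm_star_apply_of_mem_vectorStateCentralizer (hP : P ∈ vectorStateCentralizer M v) :
    ‖star P v‖ = ‖P v‖ := by
  have h := inner_star_apply_eq_of_mem_vectorStateCentralizer hP (star_mem hP.1)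
  rw [star_star, inner_self_eq_norm_sq_to_K, inner_self_eq_norm_sq_to_K] at h
  exact ((sq_eq_sq₀ (norm_nonneg _) (norm_nonneg _)).1 (mod_cast h)).symm

theorem norm_star_apply_le_of_mem_closure (hA : A ∈ M)
    (hcl : star A v ∈ closure ((fun P : H →L[ℂ] H => P v) '' vectorStateCentralizer M v)) :
    ‖star A v‖ ≤ ‖A v‖ := by
  have hbound : ∀ ξ ∈ closure ((fun P : H →L[ℂ] H => P v) '' vectorStateCentralizer M v),
      ‖⟪star A v, ξ⟫_ℂ‖ ≤ ‖ξ‖ * ‖A v‖ := fun ξ hξ => by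
    refine closure_minimal ?_ (isClosed_le (f := fun ξ => ‖⟪star A v, ξ⟫_ℂ‖)
      (g := fun ξ => ‖ξ‖ * ‖A v‖) (by fun_prop) (by fun_prop)) hξ
    rintro _ ⟨P, hP, rfl⟩
    rw [Set.mem_ofPred_eq, inner_star_apply_eq_of_mem_vectorStateCentralizer hP hA,
      ← norm_star_apply_of_mem_vectorStateCentralizer hP]
    exact norm_inner_le_norm _ _
  have hself := hbound _ hcl
  rw [inner_self_eq_norm_sq_to_K, norm_pow, RCLike.norm_ofReal, abs_norm, sq] at hself
  rcases (norm_nonneg (star A v)).eq_or_lt with h0 | hpos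
  · rw [← h0]
    exact norm_nonneg _
  · exact le_of_mul_le_mul_left hself hpos

theorem apply_mem_closure_image_of_subset (hS : ∀ X ∈ S, IsSelfAdjoint X)
    {N : StarSubalgebra ℂ (H →L[ℂ] H)} (hSN : S ⊆ N) (hA : A ∈ generatedVN S) :
    A v ∈ closure ((fun P : H →L[ℂ] H => P v) '' N) := by
  let E : Submodule ℂ H := N.toSubalgebra.toSubmodule.map
    (ContinuousLinearMap.apply ℂ H v).toLinearMap
  have hinv : ∀ X ∈ S, ∀ ξ ∈ E.topologicalClosure, X ξ ∈ E.topologicalClosure :=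
    fun X hX ξ hξ => map_mem_closure X.continuous hξ <| by
      rintro _ ⟨P, hP, rfl⟩
      exact ⟨X * P, N.mul_mem (hSN hX) hP, rfl⟩
  exact apply_mem_of_mem_generatedVN hS E.isClosed_topologicalClosure hinv hA
    (subset_closure ⟨1, one_mem N, rfl⟩)

theorem subset_vectorStateCentralizer (hS : ∀ X ∈ S, IsSelfAdjoint X)
    (hright : ∀ X ∈ S, ∃ Y ∈ (generatedVN S).commutant, IsSelfAdjoint Y ∧ X v = Y v) :
    S ⊆ vectorStateCentralizer (generatedVN S) v := fun X hX => by
  obtain ⟨Y, hY, hYstar, hXY⟩ := hright X hX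
  refine ⟨mem_generatedVN_of_mem hX, fun A hA => ?_⟩
  calc ⟪v, A (X v)⟫_ℂ = ⟪v, Y (A v)⟫_ℂ := by rw [hXY, apply_comm_of_mem_commutant hA hY]
    _ = ⟪X v, A v⟫_ℂ := by rw [inner_apply_comm_of_isSelfAdjoint hYstar, hXY]
    _ = ⟪v, X (A v)⟫_ℂ := (inner_apply_comm_of_isSelfAdjoint (hS X hX) _ _).symm

theorem inner_mul_comm_of_norm_star_apply (hM : ∀ A ∈ M, ‖star A v‖ = ‖A v‖) (hA : A ∈ M)
    (hB : B ∈ M) : ⟪v, (A * B) v⟫_ℂ = ⟪v, (B * A) v⟫_ℂ := by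
  have hnorm (c : ℂ) (hc : ‖c‖ = 1) : ‖star A v + c • B v‖ = ‖star B v + c • A v‖ := by
    have hmem : star A + c • B ∈ M :=
      add_mem (star_mem hA) (M.toStarSubalgebra.smul_mem hB c)
    have hcc : c * star c = 1 := by
      rw [RCLike.star_def, RCLike.mul_conj, hc, RCLike.ofReal_one, one_pow]
    calc ‖star A v + c • B v‖ = ‖star (star A + c • B) v‖ := (hM _ hmem).symm
      _ = ‖c • (A v + star c • star B v)‖ := by
          rw [star_add, star_star, star_smul, norm_smul, hc, one_mul, add_apply, smul_apply]
      _ = ‖star B v + c • A v‖ := by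
          rw [smul_add, smul_smul, hcc, one_smul, add_comm]
  have hone := hnorm 1 norm_one
  have hneg := hnorm (-1) (by rw [norm_neg, norm_one])
  have hI := hnorm Complex.I Complex.norm_I
  have hnegI := hnorm (-Complex.I) (by rw [norm_neg, Complex.norm_I])
  simp only [one_smul, neg_smul, ← sub_eq_add_neg] at hone hneg hnegI
  calc ⟪v, A (B v)⟫_ℂ = ⟪star A v, B v⟫_ℂ := (inner_star_apply_left _ _ _).symm
    _ = ⟪star B v, A v⟫_ℂ := by
        rw [inner_eq_sum_norm_sq_div_four, inner_eq_sum_norm_sq_div_four (star B v),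
          RCLike.I_to_complex, hone, hneg, hI, hnegI]
    _ = ⟪v, B (A v)⟫_ℂ := inner_star_apply_left _ _ _

theorem isTracial_of_exists_commutant_apply_eq (hS : ∀ X ∈ S, IsSelfAdjoint X)
    (hright : ∀ X ∈ S, ∃ Y ∈ (generatedVN S).commutant, IsSelfAdjoint Y ∧ X v = Y v)
    {f : (generatedVN S).toStarSubalgebra →ₗ[ℂ] ℂ}
    (hf : ∀ A, f A = ⟪v, (A : H →L[ℂ] H) v⟫_ℂ) : IsTracial f := by
  have hnorm_le : ∀ A ∈ generatedVN S, ‖star A v‖ ≤ ‖A v‖ := fun A hA =>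
    norm_star_apply_le_of_mem_closure hA
      (apply_mem_closure_image_of_subset hS (subset_vectorStateCentralizer hS hright) (star_mem hA))
  have hnorm : ∀ A ∈ generatedVN S, ‖star A v‖ = ‖A v‖ := fun A hA =>
    (hnorm_le A hA).antisymm (by simpa only [star_star] using hnorm_le _ (star_mem hA))
  intro A B
  rw [hf, hf]
  exact inner_mul_comm_of_norm_star_apply hnorm A.2 B.2

end Trace

section Separating

variable {M : VonNeumannAlgebra H} {V L A : H →L[ℂ] H} {v : H}

theorem mul_star_eq_of_mul_mem_commutant (hV : star V * V = 1) (hVL : V * L ∈ M.commutant)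
    (hA : A ∈ M) : A * star L = star L * (star V * A * V) := by
  have hcomm := VonNeumannAlgebra.mem_commutant_iff.1 (star_mem hVL) A hA
  calc A * star L = A * star (V * L) * V := by
        rw [star_mul, mul_assoc, mul_assoc, hV, mul_one]
    _ = star L * (star V * A * V) := by
        rw [hcomm, star_mul]
        simp only [mul_assoc]

theorem inner_apply_star_of_mul_mem_commutant (hV : star V * V = 1) (hVL : V * L ∈ M.commutant)
    (hL : L v = v) (hA : A ∈ M) : ⟪v, A (star L v)⟫_ℂ = ⟪V v, A (V v)⟫_ℂ := by
  have h : A (star L v) = star L (star V (A (V v))) :=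
    DFunLike.congr_fun (mul_star_eq_of_mul_mem_commutant hV hVL hA) v
  rw [h, inner_star_apply_right, hL, inner_star_apply_right]

theorem eq_zero_of_mul_eq_zero (hV : star V * V = 1) (hVL : V * L ∈ M.commutant)
    (hL : Function.Injective L) (hA : A ∈ M) (hAV : A * V = 0) : A = 0 := by
  have hAL : A * star L = 0 := by
    rw [mul_star_eq_of_mul_mem_commutant hV hVL hA, mul_assoc, hAV, mul_zero, mul_zero]
  have hLA : L * star A = 0 := by
    simpa only [star_mul, star_star, star_zero] using congrArg star hAL
  rw [← star_eq_zero]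
  ext1 ξ
  exact hL ((DFunLike.congr_fun hLA ξ).trans L.map_zero.symm)

end Separating

section VectorFunctional

variable {M : VonNeumannAlgebra H} {f : M.toStarSubalgebra →ₗ[ℂ] ℂ} {v w : H}

theorem isNormal_of_eq_inner (hf : ∀ A, f A = ⟪v, (A : H →L[ℂ] H) w⟫_ℂ) : IsNormal f := by
  let ξ : lp (fun _ : ℕ => H) 2 := lp.single 2 0 v
  let η : lp (fun _ : ℕ => H) 2 := lp.single 2 0 w
  have hcont : Continuous[ultraweak, inferInstance]
      fun A : H →L[ℂ] H => ∑' n, ⟪ξ n, A (η n)⟫_ℂ :=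
    continuous_iInf_dom (i := ξ) (continuous_iInf_dom (i := η) continuous_induced_dom)
  have hsum (A : H →L[ℂ] H) : ∑' n, ⟪ξ n, A (η n)⟫_ℂ = ⟪v, A w⟫_ℂ := by
    rw [tsum_eq_single 0]
    · rw [lp.single_apply_self, lp.single_apply_self]
    · intro n hn
      rw [lp.single_apply_ne _ _ _ hn, inner_zero_left]
  have hcomp : ⇑f = (fun A : H →L[ℂ] H => ∑' n, ⟪ξ n, A (η n)⟫_ℂ) ∘ Subtype.val := by
    funext A
    rw [hf, Function.comp_apply, hsum]
  unfold IsNormal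
  rw [hcomp]
  exact @Continuous.comp _ _ _ (TopologicalSpace.induced Subtype.val ultraweak) ultraweak _ _ _
    hcont (@continuous_induced_dom _ _ _ ultraweak)

theorem apply_star_mul_self_of_eq_inner (hf : ∀ A, f A = ⟪v, (A : H →L[ℂ] H) v⟫_ℂ)
    (A : M.toStarSubalgebra) : f (star A * A) = ((‖(A : H →L[ℂ] H) v‖ ^ 2 : ℝ) : ℂ) := by
  rw [hf, Complex.ofReal_pow, ← Complex.coe_algebraMap, ← inner_self_eq_norm_sq_to_K]
  exact inner_star_apply_right _ _ _

theorem isState_of_eq_inner (hv : ‖v‖ = 1) (hf : ∀ A, f A = ⟪v, (A : H →L[ℂ] H) v⟫_ℂ) :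
    IsState f := by
  refine ⟨(hf 1).trans (inner_self_eq_one_of_norm_eq_one hv), fun A => ?_⟩
  rw [apply_star_mul_self_of_eq_inner hf]
  exact ⟨by rw [Complex.ofReal_re]; positivity, Complex.ofReal_im _⟩

theorem isFaithful_of_eq_inner (hf : ∀ A, f A = ⟪v, (A : H →L[ℂ] H) v⟫_ℂ)
    (hv : ∀ A ∈ M, A v = 0 → A = 0) : IsFaithful f := fun A hA => by
  rw [apply_star_mul_self_of_eq_inner hf, Complex.ofReal_eq_zero, sq_eq_zero_iff,
    norm_eq_zero] at hA
  exact Subtype.ext (hv A A.2 hA)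

end VectorFunctional

end VonNeumann

section VacuumStates

variable {α T t : ℝ} {h : OneParticle} {A : Fock →L[ℂ] Fock}

/-- The vector `1_{[0,t)}` of `L²(ℝ₊)`, at which `X(·)` takes the value `X(t)`. -/
noncomputable def indicatorIco (t : ℝ) : OneParticle :=
  indicatorConstLp 2 measurableSet_Ico (halfLine_Ico_ne_top t) 1

theorem process_eq_field (α t : ℝ) : process α t = field α (indicatorIco t) := rfl

theorem halfLine_real_Ico {a : ℝ} (b : ℝ) (ha : 0 ≤ a) :
    halfLine.real (Set.Ico a b) = max (b - a) 0 := by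
  rw [halfLine, measureReal_restrict_apply measurableSet_Ico,
    Set.inter_eq_left.2 (Set.Ico_subset_Ici_self.trans (Set.Ici_subset_Ici.2 ha)),
    Real.volume_real_Ico]

theorem isSelfAdjoint_indicatorIco (t : ℝ) : IsSelfAdjoint (indicatorIco t) :=
  isSelfAdjoint_indicatorConstLp_one _ _

theorem inner_indicatorIco_of_le (htT : t ≤ T) :
    ⟪indicatorIco T, indicatorIco t⟫_ℂ = ∫ x, indicatorIco t x ∂halfLine := by
  rw [indicatorIco, indicatorIco,
    L2.inner_indicatorConstLp_one_indicatorConstLp_one _ _ (halfLine_Ico_ne_top T)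
      (halfLine_Ico_ne_top t), Set.inter_eq_right.2 (Set.Ico_subset_Ico_right htT),
    integral_indicatorConstLp, Complex.real_smul, mul_one]
  rfl

theorem norm_indicatorIco_sq (t : ℝ) : ‖indicatorIco t‖ ^ 2 = max t 0 := by
  rw [← inner_self_eq_norm_sq (𝕜 := ℂ), indicatorIco,
    L2.inner_indicatorConstLp_one_indicatorConstLp_one _ _ (halfLine_Ico_ne_top t)
      (halfLine_Ico_ne_top t), RCLike.ofReal_re, Set.inter_self, halfLine_real_Ico t le_rfl,
    sub_zero]

theorem norm_mul_norm_indicatorIco_le_one (hT : α ^ 2 * T ≤ 1) :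
    ‖(α : ℂ)‖ * ‖indicatorIco T‖ ≤ 1 := by
  refine (sq_le_one_iff₀ (by positivity)).1 ?_
  rw [mul_pow, norm_indicatorIco_sq, Complex.norm_real, Real.norm_eq_abs, sq_abs,
    mul_max_of_nonneg _ _ (sq_nonneg α), mul_zero]
  exact max_le hT zero_le_one

theorem exists_norm_eq_one_inner_indicatorIco_eq_zero (T : ℝ) :
    ∃ h : OneParticle, ‖h‖ = 1 ∧ ∀ t ∈ Set.Icc 0 T, ⟪indicatorIco t, h⟫_ℂ = 0 := by
  have hfin : halfLine (Set.Ico |T| (|T| + 1)) ≠ ∞ :=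
    ((Measure.restrict_apply_le _ _).trans_lt measure_Ico_lt_top).ne
  refine ⟨indicatorConstLp 2 measurableSet_Ico hfin 1, ?_, fun t ht => ?_⟩
  · rw [norm_indicatorConstLp two_ne_zero ENNReal.ofNat_ne_top, norm_one, one_mul,
      halfLine_real_Ico _ (abs_nonneg T), add_sub_cancel_left, max_eq_left zero_le_one,
      Real.one_rpow]
  · have hdisj : Set.Ico 0 t ∩ Set.Ico |T| (|T| + 1) = ∅ :=
      Set.disjoint_iff_inter_eq_empty.1
        ((Set.Ico_disjoint_Ico_same (a := 0) (b := |T|)).mono_left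
          (Set.Ico_subset_Ico_right (ht.2.trans (le_abs_self T))))
    rw [indicatorIco, L2.inner_indicatorConstLp_one_indicatorConstLp_one _ _
      (halfLine_Ico_ne_top t) hfin, hdisj,
      measureReal_empty, RCLike.ofReal_zero]

theorem isSelfAdjoint_process (α t : ℝ) : IsSelfAdjoint (process α t) :=
  isSelfAdjoint_field α (isSelfAdjoint_indicatorIco t)

theorem mem_commutant_processVN {Y : Fock →L[ℂ] Fock}
    (hY : ∀ t ∈ Set.Icc 0 T, Commute (process α t) Y) : Y ∈ (processVN α T).commutant := by
  refine mem_commutant_generatedVN ?_ ?_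
  · rintro _ ⟨t, -, rfl⟩
    exact isSelfAdjoint_process α t
  · rintro _ ⟨t, ht, rfl⟩
    exact hY t ht

/-- The operator `1 + α r⁻(1_{[0,T)})`, which intertwines the `X(t)`, `0 ≤ t ≤ T`, with a free
Brownian motion with drift. -/
noncomputable def intertwiner (α T : ℝ) : Fock →L[ℂ] Fock :=
  1 + (α : ℂ) • rightAnnihilation (indicatorIco T)

theorem intertwiner_vacuum (α T : ℝ) : intertwiner α T vacuum = vacuum := by
  rw [intertwiner, add_apply, smul_apply, rightAnnihilation_vacuum, smul_zero, add_zero,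
    one_apply_eq_self]

theorem correction_vacuum (α T : ℝ) : correction α T vacuum = star (intertwiner α T) vacuum := by
  rw [correction, intertwiner, star_add, star_one, star_smul, star_rightAnnihilation,
    RCLike.star_def, Complex.conj_ofReal, add_apply, add_apply, smul_apply, smul_apply,
    process_eq_field, field_vacuum, rightCreation_vacuum]

theorem injective_intertwiner (hT : α ^ 2 * T ≤ 1) : Function.Injective (intertwiner α T) :=
  injective_one_add_smul_rightAnnihilation (norm_mul_norm_indicatorIco_le_one hT)

theorem rightCreation_mul_intertwiner_mem_commutant (α : ℝ)
    (horth : ∀ t ∈ Set.Icc 0 T, ⟪indicatorIco t, h⟫_ℂ = 0) :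
    rightCreation h * intertwiner α T ∈ (processVN α T).commutant :=
  mem_commutant_processVN fun t ht =>
    commute_field_rightCreation_mul α (horth t ht) (inner_indicatorIco_of_le ht.2)

theorem rightCreation_mul_rightField_mul_mem_commutant (α : ℝ)
    (horth : ∀ t ∈ Set.Icc 0 T, ⟪indicatorIco t, h⟫_ℂ = 0) {f : OneParticle}
    (hf : IsSelfAdjoint f) :
    rightCreation h * rightField f * rightAnnihilation h ∈ (processVN α T).commutant :=
  mem_commutant_processVN fun t ht =>
    commute_field_rightCreation_rightField α (isSelfAdjoint_indicatorIco t) hf (horth t ht)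

theorem star_rightCreation_mul_self (hh : ‖h‖ = 1) :
    star (rightCreation h) * rightCreation h = 1 := by
  rw [star_rightCreation, rightAnnihilation_mul_rightCreation,
    inner_self_eq_one_of_norm_eq_one hh, one_smul]

theorem rightAnnihilation_rightCreation (hh : ‖h‖ = 1) (ξ : Fock) :
    rightAnnihilation h (rightCreation h ξ) = ξ :=
  DFunLike.congr_fun (star_rightCreation_mul_self hh) ξ

theorem norm_rightCreation_vacuum (hh : ‖h‖ = 1) : ‖rightCreation h vacuum‖ = 1 :=
  ((rightCreation h).norm_map_iff_adjoint_comp_self.2 (star_rightCreation_mul_self hh)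
    vacuum).trans norm_vacuum

theorem psi_eq_inner_rightCreation_vacuum (hh : ‖h‖ = 1)
    (horth : ∀ t ∈ Set.Icc 0 T, ⟪indicatorIco t, h⟫_ℂ = 0)
    (A : (processVN α T).toStarSubalgebra) :
    psi α T A = ⟪rightCreation h vacuum, (A : Fock →L[ℂ] Fock) (rightCreation h vacuum)⟫_ℂ := by
  rw [← inner_apply_star_of_mul_mem_commutant (star_rightCreation_mul_self hh)
    (rightCreation_mul_intertwiner_mem_commutant α horth) (intertwiner_vacuum α T) A.2,
    ← correction_vacuum]
  rfl

theorem exists_commutant_apply_rightCreation_vacuum (α : ℝ) (hh : ‖h‖ = 1)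
    (horth : ∀ t ∈ Set.Icc 0 T, ⟪indicatorIco t, h⟫_ℂ = 0) (ht : t ∈ Set.Icc 0 T) :
    ∃ Y ∈ (processVN α T).commutant, IsSelfAdjoint Y ∧
      process α t (rightCreation h vacuum) = Y (rightCreation h vacuum) := by
  have hf := isSelfAdjoint_indicatorIco t
  refine ⟨rightCreation h * rightField (indicatorIco t) * rightAnnihilation h +
      ((α : ℂ) * ∫ x, indicatorIco t x ∂halfLine) • 1,
    add_mem (rightCreation_mul_rightField_mul_mem_commutant α horth hf)
      ((processVN α T).commutant.toStarSubalgebra.smul_mem (one_mem _) _),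
    .add ((isSelfAdjoint_rightField _).conjugate _) ((isSelfAdjoint_drift α hf).smul (.one _)), ?_⟩
  have hfield : process α t (rightCreation h vacuum) =
      rightCreation h (driftedField α (indicatorIco t) vacuum) :=
    DFunLike.congr_fun (field_mul_rightCreation α (horth t ht)) vacuum
  rw [hfield, add_apply, smul_apply, one_apply_eq_self]
  change _ = rightCreation h (rightField _ (rightAnnihilation h (rightCreation h vacuum))) + _
  rw [rightAnnihilation_rightCreation hh, rightField_vacuum, driftedField, add_apply, add_apply,
    smul_apply, one_apply_eq_self, annihilation_vacuum, add_zero, map_add, map_smul]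

theorem mul_rightCreation_eq_zero_of_apply_vacuum (hh : ‖h‖ = 1)
    (horth : ∀ t ∈ Set.Icc 0 T, ⟪indicatorIco t, h⟫_ℂ = 0) (hA : A ∈ processVN α T)
    (hvac : A (rightCreation h vacuum) = 0) : A * rightCreation h = 0 := by
  have hker : (A * rightCreation h).toLinearMap.ker = ⊤ := by
    refine eq_top_of_rightField_mem (A * rightCreation h).isClosed_ker hvac fun f hf ξ hξ => ?_
    have hcomm := apply_comm_of_mem_commutant hA
      (rightCreation_mul_rightField_mul_mem_commutant α horth hf) (rightCreation h ξ)
    change A (rightCreation h (rightField f (rightAnnihilation h (rightCreation h ξ)))) =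
      (rightCreation h * rightField f * rightAnnihilation h) (A (rightCreation h ξ)) at hcomm
    rwa [rightAnnihilation_rightCreation hh, show A (rightCreation h ξ) = 0 from hξ,
      map_zero] at hcomm
  exact ContinuousLinearMap.coe_injective (LinearMap.ker_eq_top.1 hker)

theorem eq_zero_of_apply_rightCreation_vacuum (hT : α ^ 2 * T ≤ 1) (hh : ‖h‖ = 1)
    (horth : ∀ t ∈ Set.Icc 0 T, ⟪indicatorIco t, h⟫_ℂ = 0) (hA : A ∈ processVN α T)
    (hvac : A (rightCreation h vacuum) = 0) : A = 0 :=
  eq_zero_of_mul_eq_zero (star_rightCreation_mul_self hh)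
    (rightCreation_mul_intertwiner_mem_commutant α horth) (injective_intertwiner hT) hA
    (mul_rightCreation_eq_zero_of_apply_vacuum hh horth hA hvac)

theorem eq_zero_of_apply_vacuum (hT : α ^ 2 * T ≤ 1) (hA : A ∈ processVN α T)
    (hvac : A vacuum = 0) : A = 0 := by
  obtain ⟨h, hh, horth⟩ := exists_norm_eq_one_inner_indicatorIco_eq_zero T
  refine eq_zero_of_apply_rightCreation_vacuum hT hh horth hA ?_
  have hcomm := apply_comm_of_mem_commutant hA
    (rightCreation_mul_intertwiner_mem_commutant α horth) vacuum
  rwa [hvac, map_zero, mul_apply_eq_comp, intertwiner_vacuum] at hcomm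

theorem isState_phi (α T : ℝ) : IsState (phi α T) :=
  isState_of_eq_inner norm_vacuum fun _ => rfl

theorem isNormal_phi (α T : ℝ) : IsNormal (phi α T) :=
  isNormal_of_eq_inner fun _ => rfl

theorem isFaithful_phi (hT : α ^ 2 * T ≤ 1) : IsFaithful (phi α T) :=
  isFaithful_of_eq_inner (fun _ => rfl) fun _ => eq_zero_of_apply_vacuum hT

theorem isState_psi (α T : ℝ) : IsState (psi α T) := by
  obtain ⟨h, hh, horth⟩ := exists_norm_eq_one_inner_indicatorIco_eq_zero T
  exact isState_of_eq_inner (norm_rightCreation_vacuum hh)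
    (psi_eq_inner_rightCreation_vacuum hh horth)

theorem isNormal_psi (α T : ℝ) : IsNormal (psi α T) :=
  isNormal_of_eq_inner fun _ => rfl

theorem isFaithful_psi (hT : α ^ 2 * T ≤ 1) : IsFaithful (psi α T) := by
  obtain ⟨h, hh, horth⟩ := exists_norm_eq_one_inner_indicatorIco_eq_zero T
  exact isFaithful_of_eq_inner (psi_eq_inner_rightCreation_vacuum hh horth)
    fun _ => eq_zero_of_apply_rightCreation_vacuum hT hh horth

theorem isTracial_psi (α T : ℝ) : IsTracial (psi α T) := by
  obtain ⟨h, hh, horth⟩ := exists_norm_eq_one_inner_indicatorIco_eq_zero T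
  refine isTracial_of_exists_commutant_apply_eq ?_ ?_ (psi_eq_inner_rightCreation_vacuum hh horth)
  · rintro _ ⟨t, -, rfl⟩
    exact isSelfAdjoint_process α t
  · rintro _ ⟨t, ht, rfl⟩
    exact exists_commutant_apply_rightCreation_vacuum α hh horth ht

end VacuumStates

end TwoStateFree

theorem mainTheorem6_general (α T : ℝ) (hT : α ^ 2 * T ≤ 1) :
    (TwoStateFree.IsState (TwoStateFree.phi α T) ∧
      TwoStateFree.IsNormal (TwoStateFree.phi α T) ∧
      TwoStateFree.IsFaithful (TwoStateFree.phi α T)) ∧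
    (TwoStateFree.IsState (TwoStateFree.psi α T) ∧
      TwoStateFree.IsNormal (TwoStateFree.psi α T) ∧
      TwoStateFree.IsFaithful (TwoStateFree.psi α T) ∧
      TwoStateFree.IsTracial (TwoStateFree.psi α T)) :=
  ⟨⟨TwoStateFree.isState_phi α T, TwoStateFree.isNormal_phi α T,
      TwoStateFree.isFaithful_phi hT⟩,
    TwoStateFree.isState_psi α T, TwoStateFree.isNormal_psi α T,
      TwoStateFree.isFaithful_psi hT, TwoStateFree.isTracial_psi α T⟩

theorem mainTheorem6 (α : ℝ) (hα : α ≠ 0) (T : ℝ) (hT : T = 1 / α ^ 2) :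
    (TwoStateFree.IsState (TwoStateFree.phi α T) ∧
      TwoStateFree.IsNormal (TwoStateFree.phi α T) ∧
      TwoStateFree.IsFaithful (TwoStateFree.phi α T)) ∧
    (TwoStateFree.IsState (TwoStateFree.psi α T) ∧
      TwoStateFree.IsNormal (TwoStateFree.psi α T) ∧
      TwoStateFree.IsFaithful (TwoStateFree.psi α T) ∧
      TwoStateFree.IsTracial (TwoStateFree.psi α T)) := by
  exact mainTheorem6_general α T (by rw [hT, mul_one_div_cancel (pow_ne_zero 2 hα)])
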